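/- Let $d,n$ be positive integers and, with $S^1=\{\lambda\in\mathbb C : |\lambda|=1\}$, let $\mathbb S^1_d=\{(\lambda,\lambda^2,\dots,\lambda^d) : \lambda\in S^1\}\subseteq\mathbb C^d$ and let $\Omega=\mathrm{conv}\,\mathbb S^1_d$ be its convex hull. A matrix convex set in $d$ free dimensions is a graded set $\mathbb K=\bigcup_n\mathbb K_n$, $\mathbb K_n\subseteq M_n(\mathbb C)^d$, such that $\bigl(\sum_{j} X_j^*A_{j,1}X_j,\dots,\sum_j X_j^*A_{j,d}X_j\bigr)\in\mathbb K_m$ whenever $A_j=(A_{j,1},\dots,A_{j,d})\in\mathbb K_{n_j}$ and $X_j:\mathbb C^m\to\mathbb C^{n_j}$ ($1\le j\le\ell$) are linear maps with $\sum_{j=1}^{\ell}X_j^*X_j=1_m$. Let $\mathbb K^{\min}(\Omega)$ and $\mathbb K^{\max}(\Omega)$ be the smallest and the largest matrix convex sets whose first level $\mathbb K_1$ is $\Omega$. For $a=(a_1,\dots,a_d)$ and $c$, let $\mathrm{Toep}(c;a)$ be the $(d+1)\times(d+1)$ Toeplitz matrix with diagonal entries $c$, with $(i,j)$ entry $a_{i-j}$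 for $i>j$ and $a_{j-i}^*$ for $i<j$. For $T=(T_1,\dots,T_d)\in M_n(\mathbb C)^d$, the Toeplitz modulus and the Toeplitz numerical radius of $T$ are $$\rho(T)=\inf\{\alpha\ge 0 : \mathrm{Toep}(\alpha 1_n;T)\ \text{is positive semidefinite}\},$$ $$\omega(T)=\inf\{\alpha\ge 0 : \mathrm{Toep}\bigl(\alpha;\langle T_1\xi,\xi\rangle,\dots,\langle T_d\xi,\xi\rangle\bigr)\ \text{is positive semidefinite for every unit vector }\xi\in\mathbb C^n\}.$$ Theorem. Let $A,B\in M_n(\mathbb C)^d$. (1) The following are equivalent: $A\in\mathbb K^{\min}(\Omega)$; there are a Hilbert space $H$, an isometry $V:\mathbb C^n\to H$ and commuting normal operators $N_1,\dots,N_d$ on $H$ with $A_k=V^*N_kV$ for all $k$, whose Gelfand joint spectrum $\{(\pi(N_1),\dots,\pi(N_d)) : \pi \text{ a unital homomorphism } C^*(N_1,\dots,N_d)\to\mathbb C\}$ is contained in $\Omega$; $\rho(A)\le 1$. (2) The following are equivalent: $B\in\mathbb K^{\max}(\Omega)$; the joint numerical range $\{(\langle B_1\xi,\xi\rangle,\dots,\langle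 B_d\xi,\xi\rangle) : \xi\in\mathbb C^n,\ \|\xi\|=1\}$ is contained in $\Omega$; $\omega(B)\le 1$. -/

import Mathlib

universe u

namespace ToeplitzTuple

/-- A `d`-tuple of complex `n × n` matrices; the entry `A k` with `k : Fin d` is the matrix usually
written with the index `k + 1`. -/
abbrev Tuple (d n : ℕ) : Type := Fin d → Matrix (Fin n) (Fin n) ℂ

/-- The `(d+1) × (d+1)` Toeplitz matrix with `c` on the diagonal, with `a₁, …, a_d` (that is
`a 0, …, a (d-1)`) below the diagonal in the first column, and with their adjoints
`a₁*, …, a_d*` right of the diagonal in the first row. -/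
def toeplitz {R : Type*} [Star R] {d : ℕ} (c : R) (a : Fin d → R) :
    Matrix (Fin (d + 1)) (Fin (d + 1)) R :=
  Matrix.of fun i j =>
    if h₁ : (j : ℕ) < i then a ⟨(i : ℕ) - j - 1, by omega⟩
    else if h₂ : (i : ℕ) < j then star (a ⟨(j : ℕ) - i - 1, by omega⟩)
    else c

open scoped ComplexOrder in
/-- The Toeplitz modulus `ρ(A)`: the infimum of all `α ≥ 0` for which the block Toeplitz matrix
with diagonal blocks `α 1` and lower blocks `A₁, …, A_d`, viewed as a complex matrix of size
`(d+1) n`, is positive semidefinite. -/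
noncomputable def toeplitzModulus {d n : ℕ} (A : Tuple d n) : ℝ :=
  sInf {α : ℝ | 0 ≤ α ∧
    (Matrix.comp (Fin (d + 1)) (Fin (d + 1)) (Fin n) (Fin n) ℂ
      (toeplitz ((α : ℂ) • (1 : Matrix (Fin n) (Fin n) ℂ)) A)).PosSemidef}

/-- The point `(⟨A₁ ξ, ξ⟩, …, ⟨A_d ξ, ξ⟩)` of `ℂ^d`. -/
def quadPoint {d n : ℕ} (A : Tuple d n) (ξ : Fin n → ℂ) : Fin d → ℂ :=
  fun k => star ξ ⬝ᵥ (A k).mulVec ξ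

open scoped ComplexOrder in
/-- The Toeplitz numerical radius `ω(A)`: the infimum of all `α ≥ 0` such that, for every unit
vector `ξ`, the scalar Toeplitz matrix with diagonal `α` and first column `α, ⟨A₁ ξ, ξ⟩, …, ⟨A_d ξ, ξ⟩`
is positive semidefinite; the entries above the diagonal are
`conj ⟨A_k ξ, ξ⟩ = ⟨A_k* ξ, ξ⟩`. -/
noncomputable def toeplitzNumericalRadius {d n : ℕ} (A : Tuple d n) : ℝ :=
  sInf {α : ℝ | 0 ≤ α ∧ ∀ ξ : Fin n → ℂ, star ξ ⬝ᵥ ξ = 1 →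
    (toeplitz (α : ℂ) (quadPoint A ξ)).PosSemidef}

/-- The power stretching `{(z, z², …, z^d) : |z| = 1}` of the unit circle across `d` complex
dimensions. -/
def powerStretching (d : ℕ) : Set (Fin d → ℂ) :=
  {p | ∃ z : ℂ, ‖z‖ = 1 ∧ ∀ k : Fin d, p k = z ^ ((k : ℕ) + 1)}

/-- Matrix convexity of a graded set `K = ⋃ₙ Kₙ`, `Kₙ ⊆ M_n(ℂ)^d`. -/
def IsMatrixConvex {d : ℕ} (K : (n : ℕ) → Set (Tuple d n)) : Prop :=
  ∀ (l m : ℕ) (n : Fin l → ℕ) (A : (j : Fin l) → Tuple d (n j))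
    (X : (j : Fin l) → Matrix (Fin (n j)) (Fin m) ℂ),
    (∀ j, A j ∈ K (n j)) → ∑ j, (X j).conjTranspose * X j = 1 →
    (fun k => ∑ j, (X j).conjTranspose * A j k * X j) ∈ K m

/-- The subset of `M_1(ℂ)^d` that corresponds to `Ω ⊆ ℂ^d`. -/
def levelOne {d : ℕ} (Ω : Set (Fin d → ℂ)) : Set (Tuple d 1) :=
  {A | (fun k => A k 0 0) ∈ Ω}

/-- The matrix convex sets in `d` free dimensions whose first level is `Ω`. -/
def matrixConvexOver {d : ℕ} (Ω : Set (Fin d → ℂ)) : Set ((n : ℕ) → Set (Tuple d n)) :=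
  {K | IsMatrixConvex K ∧ K 1 = levelOne Ω}

/-- The smallest matrix convex set with first level `Ω`: the levelwise intersection of all of
them. See `isLeast_kMin`. -/
def kMin {d : ℕ} (Ω : Set (Fin d → ℂ)) : (n : ℕ) → Set (Tuple d n) :=
  sInf (matrixConvexOver Ω)

/-- The largest matrix convex set with first level `Ω`: the levelwise union of all of them.
See `isGreatest_kMax`. -/
def kMax {d : ℕ} (Ω : Set (Fin d → ℂ)) : (n : ℕ) → Set (Tuple d n) :=
  sSup (matrixConvexOver Ω)

/-- The (spatial) joint numerical range. -/
def jointNumericalRange {d n : ℕ} (A : Tuple d n) : Set (Fin d → ℂ) :=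
  {p | ∃ ξ : Fin n → ℂ, star ξ ⬝ᵥ ξ = 1 ∧ p = quadPoint A ξ}

/-- The tuples whose joint numerical range lies in a convex set `Ω` form a matrix convex set. -/
theorem isMatrixConvex_range {d : ℕ} {Ω : Set (Fin d → ℂ)} (hΩ : Convex ℝ Ω) :
    IsMatrixConvex fun n => {A : Tuple d n | jointNumericalRange A ⊆ Ω} := by
  rintro l m n A X hA hX p ⟨ξ, hξ, rfl⟩
  have key : ∀ (j : Fin l) (M : Matrix (Fin (n j)) (Fin (n j)) ℂ),
      star ξ ⬝ᵥ ((X j).conjTranspose * M * X j).mulVec ξ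
        = star ((X j).mulVec ξ) ⬝ᵥ M.mulVec ((X j).mulVec ξ) := by
    intro j M
    rw [Matrix.star_mulVec, ← Matrix.dotProduct_mulVec, Matrix.mulVec_mulVec, Matrix.mulVec_mulVec,
      Matrix.mul_assoc]
  set w : Fin l → ℝ := fun j => ∑ i, ‖(X j).mulVec ξ i‖ ^ 2 with hw
  have hself : ∀ (k : ℕ) (v : Fin k → ℂ), star v ⬝ᵥ v = ((∑ i, ‖v i‖ ^ 2 : ℝ) : ℂ) := by
    intro k v
    simp [dotProduct, Complex.conj_mul']
  have hw0 : ∀ j, 0 ≤ w j := fun j => Finset.sum_nonneg fun i _ => by positivity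
  have hw1 : ∑ j, w j = 1 := by
    have h1 : star ξ ⬝ᵥ (∑ j, (X j).conjTranspose * X j).mulVec ξ = 1 := by
      rw [hX, Matrix.one_mulVec, hξ]
    rw [Matrix.sum_mulVec, dotProduct_sum] at h1
    have h2 : ∀ j, star ξ ⬝ᵥ ((X j).conjTranspose * X j).mulVec ξ = ((w j : ℝ) : ℂ) := by
      intro j
      have := key j 1
      rw [Matrix.mul_one, Matrix.one_mulVec, hself] at this
      exact this
    simp only [h2] at h1
    exact_mod_cast h1
  have hpt : ∀ j, w j ≠ 0 → ∃ q ∈ Ω, ∀ k, star ((X j).mulVec ξ) ⬝ᵥ (A j k).mulVec ((X j).mulVec ξ)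
      = (w j : ℂ) * q k := by
    intro j hj
    set v := (X j).mulVec ξ with hv
    have hpos : 0 < w j := lt_of_le_of_ne (hw0 j) (Ne.symm hj)
    set c : ℂ := (((Real.sqrt (w j))⁻¹ : ℝ) : ℂ) with hc
    have hcs : star c = c := by simp [hc]
    have hcc : c * c * (w j : ℂ) = 1 := by
      rw [hc]
      norm_cast
      rw [← mul_inv, Real.mul_self_sqrt hpos.le, inv_mul_cancel₀ hj]
    refine ⟨quadPoint (A j) (c • v), hA j ⟨c • v, ?_, rfl⟩, ?_⟩
    · rw [star_smul, smul_dotProduct, dotProduct_smul, hself, hcs, smul_eq_mul, smul_eq_mul,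
        ← mul_assoc]
      exact hcc
    · intro k
      simp only [quadPoint]
      rw [star_smul, Matrix.mulVec_smul, smul_dotProduct, dotProduct_smul, hcs, smul_eq_mul,
        smul_eq_mul]
      linear_combination (-(star v ⬝ᵥ (A j k).mulVec v)) * hcc
  classical
  have hv0 : ∀ j, w j = 0 → (X j).mulVec ξ = 0 := by
    intro j hj
    funext i
    have := (Finset.sum_eq_zero_iff_of_nonneg (fun i _ => by positivity)).1 hj i (Finset.mem_univ i)
    simpa using this
  choose! q hq hqe using hpt
  have hmem : ∑ j ∈ Finset.univ.filter (fun j => w j ≠ 0), w j • q j ∈ Ω := by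
    refine hΩ.sum_mem (fun j _ => hw0 j) ?_ (fun j hj => hq j (Finset.mem_filter.1 hj).2)
    rw [Finset.sum_filter_ne_zero, hw1]
  convert hmem using 1
  funext k
  simp only [quadPoint]
  rw [Matrix.sum_mulVec, dotProduct_sum, Finset.sum_apply, Finset.sum_filter]
  refine Finset.sum_congr rfl fun j _ => ?_
  rw [key]
  by_cases hj : w j = 0
  · simp [hj, hv0 j hj]
  · rw [if_pos hj, hqe j hj k]
    simp

theorem le_range_of_mem {d : ℕ} {Ω : Set (Fin d → ℂ)} {K : (n : ℕ) → Set (Tuple d n)}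
    (hK : K ∈ matrixConvexOver Ω) : K ≤ fun n => {A : Tuple d n | jointNumericalRange A ⊆ Ω} := by
  rintro n A hA p ⟨ξ, hξ, rfl⟩
  have h := hK.1 1 1 (fun _ => n) (fun _ => A) (fun _ => Matrix.of fun i _ => ξ i) (fun _ => hA)
    (by
      ext i j
      have hi : i = j := Subsingleton.elim _ _
      subst hi
      simpa [Matrix.mul_apply, dotProduct] using hξ)
  rw [hK.2] at h
  change (fun k => _) ∈ Ω at h
  convert h using 1
  funext k
  simp [quadPoint, Matrix.mul_assoc, Matrix.mul_apply, dotProduct, Matrix.mulVec]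

theorem range_mem {d : ℕ} {Ω : Set (Fin d → ℂ)} (hΩ : Convex ℝ Ω) :
    (fun n => {A : Tuple d n | jointNumericalRange A ⊆ Ω}) ∈ matrixConvexOver Ω := by
  refine ⟨isMatrixConvex_range hΩ, ?_⟩
  have hq : ∀ (A : Tuple d 1) (ξ : Fin 1 → ℂ), star ξ ⬝ᵥ ξ = 1 →
      quadPoint A ξ = fun k => A k 0 0 := by
    intro A ξ hξ
    funext k
    simp [quadPoint, dotProduct, Matrix.mulVec] at hξ ⊢
    linear_combination (A k 0 0) * hξ
  ext A
  constructor
  · intro h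
    have h1 : star (fun _ : Fin 1 => (1 : ℂ)) ⬝ᵥ (fun _ => 1) = 1 := by simp [dotProduct]
    have := h ⟨_, h1, rfl⟩
    rwa [hq A _ h1] at this
  · rintro h p ⟨ξ, hξ, rfl⟩
    rw [hq A ξ hξ]
    exact h

theorem isGreatest_kMax {d : ℕ} {Ω : Set (Fin d → ℂ)} (hΩ : Convex ℝ Ω) :
    IsGreatest (matrixConvexOver Ω) (kMax Ω) := by
  have h : kMax Ω = fun n => {A : Tuple d n | jointNumericalRange A ⊆ Ω} :=
    le_antisymm (sSup_le fun K hK => le_range_of_mem hK) (le_sSup (range_mem hΩ))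
  exact ⟨h ▸ range_mem hΩ, fun K hK => le_sSup hK⟩

theorem mem_kMin {d n : ℕ} {Ω : Set (Fin d → ℂ)} {A : Tuple d n} :
    A ∈ kMin Ω n ↔ ∀ K ∈ matrixConvexOver Ω, A ∈ K n := by
  simp [kMin, sInf_apply]

theorem isLeast_kMin {d : ℕ} {Ω : Set (Fin d → ℂ)} (hΩ : Convex ℝ Ω) :
    IsLeast (matrixConvexOver Ω) (kMin Ω) := by
  refine ⟨⟨?_, ?_⟩, fun K hK => sInf_le hK⟩
  · intro l m n A X hA hX
    rw [mem_kMin]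
    exact fun K hK => hK.1 l m n A X (fun j => mem_kMin.1 (hA j) K hK) hX
  · ext A
    rw [mem_kMin]
    exact ⟨fun h => (range_mem hΩ).2 ▸ h _ (range_mem hΩ), fun h K hK => hK.2 ▸ h⟩

section Hilbert

variable {d : ℕ} {H : Type u} [NormedAddCommGroup H] [InnerProductSpace ℂ H] [CompleteSpace H]

/-- A normal tuple: commuting normal operators. -/
def IsNormalTuple (N : Fin d → H →L[ℂ] H) : Prop :=
  (∀ k, IsStarNormal (N k)) ∧ ∀ j k, Commute (N j) (N k)

/-- The unital C*-algebra generated by a tuple of operators. -/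
noncomputable def cstarGenerated (N : Fin d → H →L[ℂ] H) : StarSubalgebra ℂ (H →L[ℂ] H) :=
  (StarAlgebra.adjoin ℂ (Set.range N)).topologicalClosure

theorem mem_cstarGenerated (N : Fin d → H →L[ℂ] H) (k : Fin d) : N k ∈ cstarGenerated N :=
  StarSubalgebra.le_topologicalClosure _ (StarAlgebra.subset_adjoin ℂ _ (Set.mem_range_self k))

/-- The Gelfand joint spectrum: all `(π(N₁), …, π(N_d))` with `π` a unital homomorphism from the
generated C*-algebra to `ℂ`. -/
def gelfandSpectrum (N : Fin d → H →L[ℂ] H) : Set (Fin d → ℂ) :=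
  {p | ∃ π : cstarGenerated N →ₐ[ℂ] ℂ, ∀ k, p k = π ⟨N k, mem_cstarGenerated N k⟩}

end Hilbert

/-- `A` has a normal dilation with Gelfand joint spectrum in `Ω`: there are a Hilbert space `H`, an
isometric embedding `V` of `ℂⁿ` into `H`, and a normal tuple `N` on `H` with joint spectrum in `Ω`
whose compression `V* N_k V` is `A_k`. -/
def HasNormalDilation {d n : ℕ} (Ω : Set (Fin d → ℂ)) (A : Tuple d n) : Prop :=
  ∃ (H : Type u) (_ : NormedAddCommGroup H) (_ : InnerProductSpace ℂ H) (_ : CompleteSpace H)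
    (V : EuclideanSpace ℂ (Fin n) →ₗᵢ[ℂ] H) (N : Fin d → H →L[ℂ] H),
    IsNormalTuple N ∧ gelfandSpectrum N ⊆ Ω ∧
    ∀ k, (ContinuousLinearMap.adjoint V.toContinuousLinearMap) ∘L (N k) ∘L V.toContinuousLinearMap
      = Matrix.toEuclideanCLM (n := Fin n) (𝕜 := ℂ) (A k)

end ToeplitzTuple

/-! Everything reduces to positivity of `Toep(1; ·)`, and `exists_decomposition` carries the weight.
Factor `Toep(1; A) = B* B` and let `b (i, s)` be the columns of `B`. Their Gram matrix is Toeplitz,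
so the shift `b (i, s) ↦ b (i + 1, s)` preserves inner products and extends to an isometry of a
finite-dimensional space. Diagonalizing it gives `A k = ∑ⱼ xⱼ* zⱼ^(k+1) xⱼ` with `|zⱼ| = 1` and `∑ⱼ
xⱼ* xⱼ = 1`.

This formula places `A` in every matrix convex set over `Ω`, dilates `A` to powers of a diagonal
unitary, and for `n = 1` shows that `p ∈ Ω` exactly when `Toep(1; p) ≥ 0`. Conversely, the tuples
with `Toep(1; A) ≥ 0` form a matrix convex set over `Ω`, hence contain `kMin`. If a normal tuple `N`
has joint spectrum in `Ω`, Gelfand theory gives `Toep(1; N) = S* S`, and this positivity survives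
compression.

For the second part, `kMax` consists of the tuples with joint numerical range in `Ω`, and the scalar
criterion applies at each unit vector. `Matrix.sInf_shift_le_one_iff` translates the infima into
positivity at `α = 1`. -/

/-! ### Isometries of finite-dimensional spaces. -/

open scoped InnerProductSpace in
/-- Two families of vectors with the same Gram matrix are related by a linear isometry. -/
theorem exists_linearIsometry_of_inner_eq {κ E : Type*} [Fintype κ] [NormedAddCommGroup E]
    [InnerProductSpace ℂ E] [FiniteDimensional ℂ E] (v w : κ → E)
    (h : ∀ i j, ⟪v i, v j⟫_ℂ = ⟪w i, w j⟫_ℂ) :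
    ∃ U : E →ₗᵢ[ℂ] E, ∀ i, U (v i) = w i := by
  classical
  let f : (κ → ℂ) →ₗ[ℂ] E := Fintype.linearCombination ℂ v
  let g : (κ → ℂ) →ₗ[ℂ] E := Fintype.linearCombination ℂ w
  have hnorm : ∀ c, ‖f c‖ = ‖g c‖ := by
    intro c
    have hi : ⟪f c, f c⟫_ℂ = ⟪g c, g c⟫_ℂ := by
      simp only [f, g, Fintype.linearCombination_apply, sum_inner, inner_sum, inner_smul_left,
        inner_smul_right, h]
    rw [@norm_eq_sqrt_re_inner ℂ, @norm_eq_sqrt_re_inner ℂ, hi]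
  obtain ⟨r, hr⟩ := LinearMap.exists_rightInverse_of_surjective f.rangeRestrict
    (LinearMap.range_rangeRestrict f)
  have hr' : ∀ x, f (r x) = x := fun x =>
    congrArg Subtype.val (LinearMap.congr_fun hr x)
  let L : LinearMap.range f →ₗᵢ[ℂ] E :=
    { toLinearMap := g ∘ₗ r
      norm_map' := fun x => by
        rw [LinearMap.comp_apply, ← hnorm, hr', Submodule.coe_norm] }
  refine ⟨L.extend, fun i => ?_⟩
  have hf : f (Pi.single i 1) = v i := by simp [f]
  have hg : g (Pi.single i 1) = w i := by simp [g]
  have hmem : v i ∈ LinearMap.range f := ⟨_, hf⟩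
  have hext := L.extend_apply ⟨v i, hmem⟩
  rw [hext]
  change g (r ⟨v i, hmem⟩) = w i
  -- The section `r` need not send `v i` to the `i`-th basis vector, but the difference lies in `ker
  -- f`, where `g` vanishes by `hnorm`.
  rw [← hg, ← sub_eq_zero, ← map_sub, ← norm_eq_zero, ← hnorm, map_sub, hr', hf, sub_self,
    norm_zero]

open Module.End in
/-- A linear isometry of a finite-dimensional complex inner product space is diagonalizable in an
orthonormal basis. -/
theorem LinearIsometry.exists_orthonormalBasis_eigenvectors {E : Type*} [NormedAddCommGroup E]
    [InnerProductSpace ℂ E] [FiniteDimensional ℂ E] (U : E →ₗᵢ[ℂ] E) :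
    ∃ (b : OrthonormalBasis (Fin (Module.finrank ℂ E)) ℂ E) (μ : Fin (Module.finrank ℂ E) → ℂ),
      (∀ j, ‖μ j‖ = 1) ∧ ∀ j, U (b j) = μ j • b j := by
  classical
  set T : Module.End ℂ E := U.toLinearMap with hT
  have hTU : ∀ x, T x = U x := fun x => rfl
  have hnorm : ∀ (μ : ℂ) (x : E), x ≠ 0 → U x = μ • x → ‖μ‖ = 1 := by
    intro μ x hx h
    have h1 := U.norm_map x
    rw [h, norm_smul] at h1
    exact (mul_eq_right₀ (norm_ne_zero_iff.2 hx)).1 h1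
  have horth : OrthogonalFamily ℂ (fun μ : Eigenvalues T => eigenspace T μ)
      fun μ => (eigenspace T μ).subtypeₗᵢ := by
    refine OrthogonalFamily.of_pairwise fun μ ν hμν x hx y hy => ?_
    rw [mem_eigenspace_iff, hTU] at hx hy
    by_cases hx0 : x = 0
    · simp [hx0]
    by_contra hne
    have h1 := U.inner_map_map y x
    rw [hx, hy, inner_smul_left, inner_smul_right, ← mul_assoc] at h1
    have h2 := (mul_eq_right₀ hne).1 h1
    have h3 : ‖(μ : ℂ)‖ = 1 := hnorm _ _ hx0 hx
    have hy0 : y ≠ 0 := fun h => hne (by simp [h])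
    have h4 : ‖(ν : ℂ)‖ = 1 := hnorm _ _ hy0 hy
    apply hμν
    apply Subtype.ext
    have h5 : (ν : ℂ) * (starRingEnd ℂ) (ν : ℂ) = 1 := by
      rw [Complex.mul_conj', h4]; simp
    change (μ : ℂ) = (ν : ℂ)
    linear_combination (ν : ℂ) * h2 - (μ : ℂ) * h5
  have hss : T.IsFinitelySemisimple := by
    refine IsSemisimple.isFinitelySemisimple ?_
    rw [isSemisimple_iff]
    intro p hp
    refine ⟨pᗮ, ?_, Submodule.isCompl_orthogonal _⟩
    rw [mem_invtSubmodule] at hp ⊢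
    -- Injectivity and finite dimension turn `T p ⊆ p` into equality, so `pᗮ` is invariant too.
    have hmap : p.map T = p := by
      refine Submodule.eq_of_le_of_finrank_eq (Submodule.map_le_iff_le_comap.2 hp) ?_
      exact (Submodule.equivMapOfInjective T U.injective p).finrank_eq.symm
    intro x hx
    rw [Submodule.mem_comap, Submodule.mem_orthogonal]
    intro y hy
    rw [← hmap] at hy
    obtain ⟨w, hw, rfl⟩ := hy
    rw [hTU, hTU, U.inner_map_map]
    exact hx w hw
  -- Over `ℂ` the generalized eigenspaces span; by semisimplicity they are eigenspaces.
  have hint : DirectSum.IsInternal fun μ : Eigenvalues T => eigenspace T μ := by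
    rw [horth.isInternal_iff]
    change (⨆ μ : { μ // eigenspace T μ ≠ ⊥ }, eigenspace T μ)ᗮ = ⊥
    rw [iSup_ne_bot_subtype, Submodule.orthogonal_eq_bot_iff]
    rw [← iSup_maxGenEigenspace_eq_top T]
    exact congrArg _ (funext fun μ => (hss.maxGenEigenspace_eq_eigenspace μ).symm)
  refine ⟨hint.subordinateOrthonormalBasis rfl horth,
    fun j => (hint.subordinateOrthonormalBasisIndex rfl j horth : Eigenvalues T), ?_, ?_⟩
  · intro j
    refine hnorm _ _ ((hint.subordinateOrthonormalBasis rfl horth).orthonormal.ne_zero j) ?_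
    exact mem_eigenspace_iff.1 (hint.subordinateOrthonormalBasis_subordinate rfl j horth)
  · intro j
    exact mem_eigenspace_iff.1 (hint.subordinateOrthonormalBasis_subordinate rfl j horth)

/-! ### Decomposition of positive block Toeplitz matrices. -/

namespace ToeplitzTuple

open scoped ComplexOrder InnerProductSpace

/-- A tuple whose block Toeplitz matrix `Toep(1; A)` is positive semidefinite is a sum
`∑ⱼ xⱼ* (zⱼ, …, zⱼ^d) xⱼ` with unimodular `zⱼ` and `∑ⱼ xⱼ* xⱼ = 1`. -/
theorem exists_decomposition {d n : ℕ} (A : Tuple d n)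
    (h : (Matrix.comp (Fin (d + 1)) (Fin (d + 1)) (Fin n) (Fin n) ℂ
      (toeplitz (1 : Matrix (Fin n) (Fin n) ℂ) A)).PosSemidef) :
    ∃ (m : ℕ) (z : Fin m → ℂ) (x : Fin m → Fin n → ℂ), (∀ j, ‖z j‖ = 1) ∧
      (∀ s t, ∑ j, star (x j s) * x j t = (1 : Matrix (Fin n) (Fin n) ℂ) s t) ∧
      ∀ k s t, A k s t = ∑ j, star (x j s) * z j ^ ((k : ℕ) + 1) * x j t := by
  obtain ⟨B, hB⟩ : ∃ B : Matrix (Fin (d + 1) × Fin n) (Fin (d + 1) × Fin n) ℂ,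
      _ = B.conjTranspose * B := by
    open scoped MatrixOrder in
    exact CStarAlgebra.nonneg_iff_eq_star_mul_self.1 h.nonneg
  let b : Fin (d + 1) × Fin n → EuclideanSpace ℂ (Fin (d + 1) × Fin n) :=
    fun q => WithLp.toLp 2 fun r => B r q
  have hb : ∀ i s j t, ⟪b (i, s), b (j, t)⟫_ℂ =
      toeplitz (1 : Matrix (Fin n) (Fin n) ℂ) A i j s t := by
    intro i s j t
    have h1 := congrFun (congrFun hB (i, s)) (j, t)
    rw [Matrix.comp_apply] at h1
    rw [h1, Matrix.mul_apply, PiLp.inner_apply]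
    simp [b, mul_comm]
  -- The Toeplitz structure enters here: block rows and columns `0, …, d-1` and `1, …, d` carry the
  -- same Gram matrix.
  obtain ⟨U, hU⟩ := exists_linearIsometry_of_inner_eq
    (fun q : Fin d × Fin n => b (q.1.castSucc, q.2)) (fun q => b (q.1.succ, q.2)) (by
      rintro ⟨i, s⟩ ⟨j, t⟩
      simp only [hb, toeplitz, Matrix.of_apply, Fin.val_succ, Fin.val_castSucc, Nat.add_sub_add_right,
        add_lt_add_iff_right])
  have hpow : ∀ (i : ℕ) (hi : i < d + 1) s, (U ^ i) (b (0, s)) = b (⟨i, hi⟩, s) := by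
    intro i
    induction i with
    | zero => intro _ _; rfl
    | succ i ih =>
      intro hi s
      rw [pow_succ', LinearIsometry.coe_mul, Function.comp_apply, ih (by omega)]
      exact hU (⟨i, by omega⟩, s)
  obtain ⟨e, μ, hμ, he⟩ := U.exists_orthonormalBasis_eigenvectors
  have hpe : ∀ (i : ℕ) y j, ⟪(U ^ i) y, e j⟫_ℂ = star (μ j) ^ i * ⟪y, e j⟫_ℂ := by
    intro i y j
    induction i with
    | zero => simp
    | succ i ih =>
      have h1 := U.inner_map_map ((U ^ i) y) (e j)
      rw [he, inner_smul_right, ih] at h1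
      have h2 : star (μ j) * μ j = 1 := by
        rw [Complex.star_def, Complex.conj_mul', hμ]; simp
      rw [pow_succ', LinearIsometry.coe_mul, Function.comp_apply]
      linear_combination star (μ j) * h1 - ⟪U ((U ^ i) y), e j⟫_ℂ * h2
  -- The nodes are conjugate eigenvalues because the inner product is conjugate-linear in its first
  -- argument, where the power of `U` sits.
  refine ⟨_, fun j => star (μ j), fun j s => ⟪e j, b (0, s)⟫_ℂ, fun j => by simp [hμ], ?_, ?_⟩
  · intro s t
    have h1 := hb 0 s 0 t
    rw [← e.sum_inner_mul_inner] at h1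
    simpa [toeplitz] using h1
  · intro k s t
    have h1 := hb k.succ s 0 t
    rw [← e.sum_inner_mul_inner, Fin.succ, ← hpow] at h1
    simp only [hpe] at h1
    have h2 : toeplitz (1 : Matrix (Fin n) (Fin n) ℂ) A ⟨k + 1, by omega⟩ 0 s t = A k s t := by
      have h0 : (0 : Fin (d + 1)) < ⟨k + 1, by omega⟩ := Nat.succ_pos _
      simp [toeplitz, h0]
    rw [← h2, ← h1]
    refine Finset.sum_congr rfl fun j _ => ?_
    rw [Complex.star_def, inner_conj_symm]
    ring

end ToeplitzTuple

/-! ### Positive semidefinite matrices and the attained infimum. -/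

open scoped ComplexOrder

/-- Congruence of a block matrix by a block diagonal matrix with equal blocks. -/
theorem Matrix.PosSemidef.comp_congruence {ι n m : Type*} [Fintype ι] [Fintype n]
    [Fintype m] {T : Matrix ι ι (Matrix n n ℂ)} (hT : (Matrix.comp ι ι n n ℂ T).PosSemidef)
    (X : Matrix n m ℂ) :
    (Matrix.comp ι ι m m ℂ fun a b => X.conjTranspose * T a b * X).PosSemidef := by
  classical
  let Y : Matrix (ι × n) (ι × m) ℂ := fun p q => if p.1 = q.1 then X p.2 q.2 else 0
  convert hT.conjTranspose_mul_mul_same Y using 1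
  ext ⟨a, s⟩ ⟨b, t⟩
  change (X.conjTranspose * T a b * X) s t
    = (Y.conjTranspose * Matrix.comp ι ι n n ℂ T * Y) (a, s) (b, t)
  simp only [Matrix.mul_apply, Fintype.sum_prod_type, Matrix.conjTranspose_apply]
  simp [Y, apply_ite star]

/-- A Hermitian matrix with entries bounded by `C` is bounded below by `-C` times its size. -/
theorem Matrix.IsHermitian.posSemidef_smul_one_add {ι : Type*} [Fintype ι] [DecidableEq ι]
    {M : Matrix ι ι ℂ} (hM : M.IsHermitian) {C α : ℝ} (hC : ∀ i j, ‖M i j‖ ≤ C)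
    (hα : C * Fintype.card ι ≤ α) : ((α : ℂ) • (1 : Matrix ι ι ℂ) + M).PosSemidef := by
  have hα1 : ((α : ℂ) • (1 : Matrix ι ι ℂ)).IsHermitian := by
    rw [Matrix.IsHermitian, Matrix.conjTranspose_smul]
    simp
  refine Matrix.PosSemidef.of_dotProduct_mulVec_nonneg (hα1.add hM) fun x => ?_
  have him := hM.im_star_dotProduct_mulVec_self x
  rw [Matrix.add_mulVec, dotProduct_add, Matrix.smul_mulVec, Matrix.one_mulVec, dotProduct_smul]
  have hself : star x ⬝ᵥ x = ((∑ i, ‖x i‖ ^ 2 : ℝ) : ℂ) := by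
    simp [dotProduct, Complex.conj_mul']
  -- Bound `|xᵢ||xⱼ|` by the mean of the squares; the double sum then yields the factor `card ι`.
  have hbound : ‖star x ⬝ᵥ M.mulVec x‖ ≤ C * Fintype.card ι * ∑ i, ‖x i‖ ^ 2 := by
    have h1 : ‖star x ⬝ᵥ M.mulVec x‖ ≤ ∑ i, ∑ j, C * ((‖x i‖ ^ 2 + ‖x j‖ ^ 2) / 2) := by
      simp only [dotProduct, Matrix.mulVec, Finset.mul_sum]
      refine (norm_sum_le _ _).trans (Finset.sum_le_sum fun i _ => (norm_sum_le _ _).trans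
        (Finset.sum_le_sum fun j _ => ?_))
      have h0 : 0 ≤ C := (norm_nonneg _).trans (hC i j)
      simp only [Pi.star_apply, norm_mul, norm_star]
      calc ‖x i‖ * (‖M i j‖ * ‖x j‖) = ‖M i j‖ * (‖x i‖ * ‖x j‖) := by ring
        _ ≤ C * ((‖x i‖ ^ 2 + ‖x j‖ ^ 2) / 2) :=
          mul_le_mul (hC i j) (by nlinarith [sq_nonneg (‖x i‖ - ‖x j‖)]) (by positivity) h0
    refine h1.trans (le_of_eq ?_)
    simp only [← Finset.mul_sum, ← Finset.sum_div, Finset.sum_add_distrib, Finset.sum_const,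
      Finset.card_univ, nsmul_eq_mul]
    ring
  have hsum : (0 : ℝ) ≤ ∑ i, ‖x i‖ ^ 2 := Finset.sum_nonneg fun i _ => by positivity
  have hre := (abs_le.1 (Complex.abs_re_le_norm (star x ⬝ᵥ M.mulVec x))).1
  rw [hself, Complex.le_def]
  constructor
  · simp only [smul_eq_mul, Complex.add_re, Complex.zero_re, ← Complex.ofReal_mul,
      Complex.ofReal_re]
    nlinarith [mul_le_mul_of_nonneg_right hα hsum]
  · simp only [smul_eq_mul, Complex.add_im, Complex.zero_im, ← Complex.ofReal_mul,
      Complex.ofReal_im, zero_add]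
    exact him.symm

/-- The quadratic form is a limit of nonnegative ones as `ε → 0`. This handles an infimum not yet
known to be attained. -/
theorem Matrix.posSemidef_of_forall_pos {ι : Type*} [Fintype ι] [DecidableEq ι]
    {M : Matrix ι ι ℂ} (hM : M.IsHermitian)
    (h : ∀ ε : ℝ, 0 < ε → ((ε : ℂ) • (1 : Matrix ι ι ℂ) + M).PosSemidef) : M.PosSemidef := by
  refine Matrix.PosSemidef.of_dotProduct_mulVec_nonneg hM fun x => ?_
  have hlim : Filter.Tendsto (fun ε : ℝ => (ε : ℂ) * (star x ⬝ᵥ x) + star x ⬝ᵥ M.mulVec x)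
      (nhdsWithin 0 (Set.Ioi 0)) (nhds (((0 : ℝ) : ℂ) * (star x ⬝ᵥ x) + star x ⬝ᵥ M.mulVec x)) :=
    (Continuous.tendsto (by fun_prop) 0).mono_left nhdsWithin_le_nhds
  rw [Complex.ofReal_zero, zero_mul, zero_add] at hlim
  refine ge_of_tendsto hlim ?_
  filter_upwards [self_mem_nhdsWithin] with ε hε
  have := (h ε hε).dotProduct_mulVec_nonneg x
  rwa [Matrix.add_mulVec, dotProduct_add, Matrix.smul_mulVec, Matrix.one_mulVec,
    dotProduct_smul] at this

/-- For a uniformly bounded family of Hermitian matrices, the infimum of all `α ≥ 0` that shift the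
whole family into the positive semidefinite cone is attained. -/
theorem Matrix.sInf_shift_le_one_iff {κ ι : Type*} [Fintype ι] [DecidableEq ι]
    (M : κ → Matrix ι ι ℂ) (hM : ∀ t, (M t).IsHermitian) {C : ℝ} (hC : ∀ t i j, ‖M t i j‖ ≤ C) :
    sInf {α : ℝ | 0 ≤ α ∧ ∀ t, ((α : ℂ) • (1 : Matrix ι ι ℂ) + M t).PosSemidef} ≤ 1 ↔
      ∀ t, (1 + M t).PosSemidef := by
  constructor
  · intro h t
    refine Matrix.posSemidef_of_forall_pos (Matrix.isHermitian_one.add (hM t)) fun ε hε => ?_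
    -- The uniform bound matters here: for an empty set `sInf` would be `0`, and the inequality
    -- would say nothing.
    have hne : {α : ℝ | 0 ≤ α ∧ ∀ t, ((α : ℂ) • (1 : Matrix ι ι ℂ) + M t).PosSemidef}.Nonempty :=
      ⟨max 0 (C * Fintype.card ι), le_max_left _ _,
        fun t => (hM t).posSemidef_smul_one_add (hC t) (le_max_right _ _)⟩
    obtain ⟨α, ⟨_, hα⟩, hlt⟩ := exists_lt_of_csInf_lt hne
      (lt_of_le_of_lt h (lt_add_of_pos_right 1 hε))
    have hnn : (0 : ℂ) ≤ ((1 + ε - α : ℝ) : ℂ) := by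
      rw [Complex.zero_le_real]; linarith
    have hsum := (Matrix.PosSemidef.one.smul hnn).add (hα t)
    convert hsum using 1
    rw [← add_assoc, ← add_assoc, ← add_smul]
    congr 1
    nth_rewrite 2 [← one_smul ℂ (1 : Matrix ι ι ℂ)]
    rw [← add_smul]
    congr 1
    push_cast
    ring
  · intro h
    refine csInf_le ⟨0, fun α hα => hα.1⟩ ⟨zero_le_one, fun t => ?_⟩
    simpa using h t

/-! ### Toeplitz calculus, modulus and numerical radius. -/

namespace ToeplitzTuple

/-- Each entry is `c`, some `a k` or its star, so compatibility with `star` suffices. This covers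
congruences and compressions, which are not multiplicative. -/
theorem map_toeplitz {R S : Type*} [Star R] [Star S] {d : ℕ} (f : R → S)
    (hf : ∀ r, f (star r) = star (f r)) (c : R) (a : Fin d → R) (i j : Fin (d + 1)) :
    f (toeplitz c a i j) = toeplitz (f c) (fun k => f (a k)) i j := by
  simp only [toeplitz, Matrix.of_apply]
  split_ifs <;> simp [hf]

theorem sum_toeplitz {R κ : Type*} [AddCommMonoid R] [StarAddMonoid R] {d : ℕ} (s : Finset κ)
    (c : κ → R) (a : κ → Fin d → R) (i j : Fin (d + 1)) :
    toeplitz (∑ t ∈ s, c t) (fun k => ∑ t ∈ s, a t k) i j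
      = ∑ t ∈ s, toeplitz (c t) (a t) i j := by
  simp only [toeplitz, Matrix.of_apply]
  split_ifs <;> simp [star_sum]

theorem star_toeplitz {R : Type*} [InvolutiveStar R] {d : ℕ} {c : R} (hc : star c = c)
    (a : Fin d → R) (i j : Fin (d + 1)) : star (toeplitz c a i j) = toeplitz c a j i := by
  simp only [toeplitz, Matrix.of_apply]
  split_ifs <;> first | omega | exact hc | simp

theorem toeplitz_eq_add {R : Type*} [AddMonoid R] [Star R] {d : ℕ} (c : R) (a : Fin d → R)
    (i j : Fin (d + 1)) :
    toeplitz c a i j = (if i = j then c else 0) + toeplitz 0 a i j := by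
  simp only [toeplitz, Matrix.of_apply, Fin.ext_iff]
  split_ifs <;> first | omega | simp

/-- The block Toeplitz matrix `Toep(1; A)` is positive semidefinite. -/
def IsToeplitzPositive {d n : ℕ} (A : Tuple d n) : Prop :=
  (Matrix.comp (Fin (d + 1)) (Fin (d + 1)) (Fin n) (Fin n) ℂ
    (toeplitz (1 : Matrix (Fin n) (Fin n) ℂ) A)).PosSemidef

theorem comp_toeplitz_eq_add {d n : ℕ} (α : ℂ) (A : Tuple d n) :
    Matrix.comp (Fin (d + 1)) (Fin (d + 1)) (Fin n) (Fin n) ℂ (toeplitz (α • 1) A)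
      = α • 1 + Matrix.comp (Fin (d + 1)) (Fin (d + 1)) (Fin n) (Fin n) ℂ (toeplitz 0 A) := by
  ext ⟨i, s⟩ ⟨j, t⟩
  rw [Matrix.add_apply, Matrix.comp_apply, Matrix.comp_apply, toeplitz_eq_add, Matrix.add_apply]
  by_cases h : i = j <;> simp [h, Matrix.one_apply]

theorem isHermitian_comp_toeplitz {d n : ℕ} (A : Tuple d n) :
    (Matrix.comp (Fin (d + 1)) (Fin (d + 1)) (Fin n) (Fin n) ℂ (toeplitz 0 A)).IsHermitian := by
  ext ⟨i, s⟩ ⟨j, t⟩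
  change star (toeplitz 0 A j i t s) = toeplitz 0 A i j s t
  rw [← star_toeplitz (star_zero _) A j i, Matrix.star_apply]

theorem toeplitzModulus_le_one_iff {d n : ℕ} (A : Tuple d n) :
    toeplitzModulus A ≤ 1 ↔ IsToeplitzPositive A := by
  obtain ⟨C, hC⟩ := (Set.finite_range fun p : (Fin (d + 1) × Fin n) × (Fin (d + 1) × Fin n) =>
    ‖Matrix.comp (Fin (d + 1)) (Fin (d + 1)) (Fin n) (Fin n) ℂ (toeplitz 0 A) p.1 p.2‖).bddAbove
  have h := Matrix.sInf_shift_le_one_iff (κ := Unit) (fun _ => _)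
    (fun _ => isHermitian_comp_toeplitz A) (C := C) (fun _ i j => hC ⟨(i, j), rfl⟩)
  simp only [forall_const] at h
  have h1 := comp_toeplitz_eq_add 1 A
  rw [one_smul, one_smul] at h1
  rw [toeplitzModulus, IsToeplitzPositive, h1, ← h]
  simp only [comp_toeplitz_eq_add]

theorem toeplitz_eq_smul_one_add {d : ℕ} (α : ℂ) (p : Fin d → ℂ) :
    toeplitz α p = α • (1 : Matrix (Fin (d + 1)) (Fin (d + 1)) ℂ) + toeplitz 0 p := by
  ext i j
  rw [toeplitz_eq_add, Matrix.add_apply]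
  simp [Matrix.one_apply]

theorem norm_toeplitz_zero_le {d : ℕ} {p : Fin d → ℂ} {C : ℝ} (h0 : 0 ≤ C) (hC : ∀ k, ‖p k‖ ≤ C)
    (i j : Fin (d + 1)) : ‖toeplitz 0 p i j‖ ≤ C := by
  simp only [toeplitz, Matrix.of_apply]
  split_ifs <;> simp [hC, h0]

/-- A crude bound is enough; only its uniformity in `ξ` is used. -/
theorem norm_quadPoint_le {d n : ℕ} (A : Tuple d n) {ξ : Fin n → ℂ} (hξ : star ξ ⬝ᵥ ξ = 1)
    (k : Fin d) : ‖quadPoint A ξ k‖ ≤ ∑ l, ∑ i, ∑ j, ‖A l i j‖ := by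
  have hself : ∑ i, ‖ξ i‖ ^ 2 = 1 := by
    have : ((∑ i, ‖ξ i‖ ^ 2 : ℝ) : ℂ) = 1 := by
      rw [← hξ]; simp [dotProduct, Complex.conj_mul']
    exact_mod_cast this
  have hle : ∀ i, ‖ξ i‖ ≤ 1 := fun i => by
    have h1 := Finset.single_le_sum (f := fun i => ‖ξ i‖ ^ 2) (fun i _ => by positivity)
      (Finset.mem_univ i)
    rw [hself] at h1
    exact (sq_le_one_iff₀ (norm_nonneg _)).1 h1
  refine le_trans ?_ (Finset.single_le_sum (f := fun l => ∑ i, ∑ j, ‖A l i j‖)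
    (fun l _ => by positivity) (Finset.mem_univ k))
  simp only [quadPoint, dotProduct, Matrix.mulVec, Finset.mul_sum]
  refine (norm_sum_le _ _).trans (Finset.sum_le_sum fun i _ => (norm_sum_le _ _).trans
    (Finset.sum_le_sum fun j _ => ?_))
  simp only [Pi.star_apply, norm_mul, norm_star]
  calc ‖ξ i‖ * (‖A k i j‖ * ‖ξ j‖) ≤ 1 * (‖A k i j‖ * 1) := by
        gcongr <;> exact hle _
    _ = ‖A k i j‖ := by ring

theorem toeplitzNumericalRadius_le_one_iff {d n : ℕ} (A : Tuple d n) :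
    toeplitzNumericalRadius A ≤ 1 ↔
      ∀ ξ : Fin n → ℂ, star ξ ⬝ᵥ ξ = 1 → (toeplitz 1 (quadPoint A ξ)).PosSemidef := by
  have h := Matrix.sInf_shift_le_one_iff (κ := {ξ : Fin n → ℂ // star ξ ⬝ᵥ ξ = 1})
    (fun ξ => toeplitz 0 (quadPoint A ξ))
    (fun ξ => by
      ext i j
      rw [Matrix.conjTranspose_apply, star_toeplitz (star_zero _)])
    (fun ξ => norm_toeplitz_zero_le (by positivity) (norm_quadPoint_le A ξ.2))
  rw [toeplitzNumericalRadius]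
  simp only [Subtype.forall] at h
  simp only [toeplitz_eq_smul_one_add (1 : ℂ), one_smul, ← h]
  simp only [← toeplitz_eq_smul_one_add]

/-! ### The scalar criterion and the extremal matrix convex sets. -/

/-- At `(z, …, z^d)` the matrix is the rank-one `v v*` with `v i = z ^ i`, and `p ↦ Toep(1; p)` is
real-affine. -/
theorem posSemidef_toeplitz_of_mem {d : ℕ} {p : Fin d → ℂ}
    (hp : p ∈ convexHull ℝ (powerStretching d)) : (toeplitz 1 p).PosSemidef := by
  suffices h : convexHull ℝ (powerStretching d) ⊆ {p | (toeplitz 1 p).PosSemidef} from h hp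
  refine convexHull_min ?_ ?_
  · rintro p ⟨z, hz, hp⟩
    have hz1 : z * star z = 1 := by
      rw [Complex.star_def, Complex.mul_conj', hz]; simp
    have hzm : ∀ m : ℕ, z ^ m * star z ^ m = 1 := fun m => by rw [← mul_pow, hz1, one_pow]
    change (toeplitz 1 p).PosSemidef
    convert Matrix.posSemidef_vecMulVec_self_star (fun i : Fin (d + 1) => z ^ (i : ℕ)) using 1
    ext i j
    simp only [toeplitz, Matrix.of_apply, Matrix.vecMulVec_apply, Pi.star_apply, star_pow, hp]
    split_ifs with h1 h2
    · have e : (i : ℕ) = (i - j - 1 + 1) + j := by omega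
      nth_rewrite 2 [e]
      rw [pow_add z ((i : ℕ) - j - 1 + 1), mul_assoc, hzm, mul_one]
    · have e : (j : ℕ) = i + (j - i - 1 + 1) := by omega
      nth_rewrite 2 [e]
      rw [pow_add (star z) (i : ℕ), ← mul_assoc, hzm, one_mul]
    · have e : (i : ℕ) = j := by omega
      rw [e, hzm]
  · intro p hp q hq s t hs ht hst
    have hs' : (0 : ℂ) ≤ s := Complex.zero_le_real.2 hs
    have ht' : (0 : ℂ) ≤ t := Complex.zero_le_real.2 ht
    have hadd := (Matrix.PosSemidef.smul hp hs').add (Matrix.PosSemidef.smul hq ht')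
    have hst' : (s : ℂ) + t = 1 := by exact_mod_cast hst
    change (toeplitz 1 (s • p + t • q)).PosSemidef
    convert hadd using 1
    ext i j
    simp only [toeplitz, Matrix.of_apply, Matrix.add_apply, Matrix.smul_apply]
    split_ifs <;> simp [hst']

/-- This is `exists_decomposition` for `n = 1`, with the `|xⱼ|²` as convex weights. -/
theorem mem_of_posSemidef_toeplitz {d : ℕ} {p : Fin d → ℂ} (hp : (toeplitz 1 p).PosSemidef) :
    p ∈ convexHull ℝ (powerStretching d) := by
  obtain ⟨m, z, x, hz, hx, hA⟩ := exists_decomposition (n := 1)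
    (fun k => Matrix.of fun _ _ => p k) (by
      convert hp.submatrix Prod.fst using 1
      ext ⟨i, s⟩ ⟨j, t⟩
      obtain rfl := Subsingleton.elim s t
      rw [Matrix.comp_apply, Matrix.submatrix_apply,
        map_toeplitz (fun M : Matrix (Fin 1) (Fin 1) ℂ => M s s) (fun _ => rfl)]
      simp)
  have hw : ∀ j, star (x j 0) * x j 0 = ((‖x j 0‖ ^ 2 : ℝ) : ℂ) := fun j => by
    rw [Complex.star_def, Complex.conj_mul']; simp
  have hsum := hx 0 0
  simp only [hw, Matrix.one_apply_eq] at hsum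
  have hmem : ∑ j, (‖x j 0‖ ^ 2) • (fun k : Fin d => z j ^ ((k : ℕ) + 1))
      ∈ convexHull ℝ (powerStretching d) :=
    (convex_convexHull ℝ _).sum_mem (fun j _ => by positivity) (by exact_mod_cast hsum)
      (fun j _ => subset_convexHull ℝ _ ⟨z j, hz j, fun _ => rfl⟩)
  convert hmem using 1
  funext k
  have hk := hA k 0 0
  rw [Matrix.of_apply] at hk
  rw [hk, Finset.sum_apply]
  refine Finset.sum_congr rfl fun j _ => ?_
  rw [Pi.smul_apply, Complex.real_smul, ← hw]
  ring

theorem mem_convexHull_powerStretching_iff {d : ℕ} {p : Fin d → ℂ} :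
    p ∈ convexHull ℝ (powerStretching d) ↔ (toeplitz 1 p).PosSemidef :=
  ⟨posSemidef_toeplitz_of_mem, mem_of_posSemidef_toeplitz⟩

/-- Blockwise congruence by `X j` preserves positivity and the Toeplitz form; the diagonal blocks
`(X j)* X j` add up to `1`. -/
theorem isToeplitzPositive_mem_matrixConvexOver (d : ℕ) :
    (fun n => {A : Tuple d n | IsToeplitzPositive A})
      ∈ matrixConvexOver (convexHull ℝ (powerStretching d)) := by
  constructor
  · intro l m n A X hA hX
    have h := Matrix.posSemidef_sum Finset.univ fun j _ => (hA j).comp_congruence (X j)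
    change Matrix.PosSemidef _
    convert h using 1
    ext ⟨a, s⟩ ⟨b, t⟩
    rw [Matrix.sum_apply, Matrix.comp_apply, ← hX, sum_toeplitz, Matrix.sum_apply]
    refine Finset.sum_congr rfl fun j _ => ?_
    change _ = ((X j).conjTranspose * toeplitz 1 (A j) a b * X j) s t
    rw [map_toeplitz (fun M => (X j).conjTranspose * M * X j) (fun M => by
      simp [Matrix.star_eq_conjTranspose, Matrix.mul_assoc]), Matrix.mul_one]
  · ext A
    change Matrix.PosSemidef _ ↔ (fun k => A k 0 0) ∈ convexHull ℝ (powerStretching d)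
    rw [mem_convexHull_powerStretching_iff,
      ← Matrix.posSemidef_submatrix_equiv (Equiv.prodUnique (Fin (d + 1)) (Fin 1)).symm]
    have : (toeplitz 1 fun k => A k 0 0) =
        (Matrix.comp (Fin (d + 1)) (Fin (d + 1)) (Fin 1) (Fin 1) ℂ
        (toeplitz 1 A)).submatrix (Equiv.prodUnique (Fin (d + 1)) (Fin 1)).symm
          (Equiv.prodUnique (Fin (d + 1)) (Fin 1)).symm := by
      ext i j
      change _ = toeplitz 1 A i j 0 0
      rw [map_toeplitz (fun M : Matrix (Fin 1) (Fin 1) ℂ => M 0 0) (fun _ => rfl)]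
      rfl
    rw [this]

theorem mem_kMin_iff_isToeplitzPositive {d n : ℕ} (A : Tuple d n) :
    A ∈ kMin (convexHull ℝ (powerStretching d)) n ↔ IsToeplitzPositive A := by
  constructor
  · intro h
    exact mem_kMin.1 h _ (isToeplitzPositive_mem_matrixConvexOver d)
  · intro h
    obtain ⟨m, z, x, hz, hx, hA⟩ := exists_decomposition A h
    rw [mem_kMin]
    intro K hK
    -- The decomposition is a matrix convex combination of first-level points, with the `xⱼ` as `1 ×
    -- n` rows.
    have hmem := hK.1 m n (fun _ => 1) (fun j k => Matrix.of fun _ _ => z j ^ ((k : ℕ) + 1))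
      (fun j => Matrix.of fun _ t => x j t) (fun j => by
        rw [hK.2]
        exact subset_convexHull ℝ _ ⟨z j, hz j, fun _ => rfl⟩) (by
        ext s t
        rw [Matrix.sum_apply, ← hx]
        simp [Matrix.mul_apply])
    convert hmem using 1
    funext k
    ext s t
    rw [hA, Matrix.sum_apply]
    simp [Matrix.mul_apply]

theorem mem_kMax_iff {d n : ℕ} {Ω : Set (Fin d → ℂ)} (hΩ : Convex ℝ Ω) (B : Tuple d n) :
    B ∈ kMax Ω n ↔ jointNumericalRange B ⊆ Ω :=
  ⟨fun h => le_range_of_mem (isGreatest_kMax hΩ).1 n h,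
    fun h => (isGreatest_kMax hΩ).2 (range_mem hΩ) n h⟩

theorem jointNumericalRange_subset_iff {d n : ℕ} (B : Tuple d n) :
    jointNumericalRange B ⊆ convexHull ℝ (powerStretching d) ↔ toeplitzNumericalRadius B ≤ 1 := by
  rw [toeplitzNumericalRadius_le_one_iff]
  constructor
  · exact fun h ξ hξ => mem_convexHull_powerStretching_iff.1 (h ⟨ξ, hξ, rfl⟩)
  · rintro h p ⟨ξ, hξ, rfl⟩
    exact mem_convexHull_powerStretching_iff.2 (h ξ hξ)

/-! ### From positivity to a normal dilation. -/

open scoped InnerProductSpace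

theorem powerStretching_nonempty (d : ℕ) : (powerStretching d).Nonempty :=
  ⟨fun _ => 1, 1, by simp, by simp⟩

/-- The joint spectrum of the powers `W, W², …, W^d` of a unitary operator lies on the power
stretching of the circle. -/
theorem gelfandSpectrum_pow_subset {d : ℕ} {H : Type u} [NormedAddCommGroup H]
    [InnerProductSpace ℂ H] [CompleteSpace H] {W : H →L[ℂ] H} (hW : W ∈ unitary (H →L[ℂ] H)) :
    gelfandSpectrum (fun k : Fin d => W ^ ((k : ℕ) + 1)) ⊆ powerStretching d := by
  rintro p ⟨π, hp⟩
  -- For `d = 0` the generated algebra need not contain `W`, but then `ℂ^d` is a single point.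
  obtain _ | d := d
  · obtain ⟨q, hq⟩ := powerStretching_nonempty 0
    rwa [Subsingleton.elim p q]
  have hWmem : W ∈ cstarGenerated (fun k : Fin (d + 1) => W ^ ((k : ℕ) + 1)) := by
    simpa using mem_cstarGenerated (fun k : Fin (d + 1) => W ^ ((k : ℕ) + 1)) 0
  have hclosed : IsClosed
      (cstarGenerated (fun k : Fin (d + 1) => W ^ ((k : ℕ) + 1)) : Set (H →L[ℂ] H)) :=
    StarSubalgebra.isClosed_topologicalClosure _
  refine ⟨π ⟨W, hWmem⟩, ?_, fun k => ?_⟩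
  -- No star-compatibility of `π` is needed: `π W` lies in the spectrum of `W` in the generated
  -- algebra, where `W` is still unitary.
  · refine spectrum.norm_eq_one_of_unitary (𝕜 := ℂ) ?_ (AlgHom.apply_mem_spectrum π _)
    rw [Unitary.mem_iff] at hW ⊢
    exact ⟨Subtype.ext hW.1, Subtype.ext hW.2⟩
  · rw [hp, ← map_pow]
    rfl

-- In the decomposition the `xⱼ` are the rows of an isometry and the `zⱼ` the diagonal of a unitary,
-- whose powers are the dilation.
open scoped ComplexOrder in
theorem IsToeplitzPositive.hasNormalDilation {d n : ℕ} {A : Tuple d n} (h : IsToeplitzPositive A) :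
    HasNormalDilation.{u} (convexHull ℝ (powerStretching d)) A := by
  obtain ⟨m, z, x, hz, hx, hA⟩ := exists_decomposition A h
  -- The lift puts the dilation space into the universe `u`.
  let X : Matrix (ULift.{u} (Fin m)) (Fin n) ℂ := fun j s => x j.down s
  let D : Matrix (ULift.{u} (Fin m)) (ULift.{u} (Fin m)) ℂ := Matrix.diagonal fun j => z j.down
  have hX : X.conjTranspose * X = 1 := by
    ext s t
    rw [← hx, Matrix.mul_apply]
    exact Equiv.sum_comp Equiv.ulift fun j => star (x j s) * x j t
  have hXA : ∀ k : Fin d, X.conjTranspose * D ^ ((k : ℕ) + 1) * X = A k := by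
    intro k
    ext s t
    rw [hA, Matrix.mul_apply, Matrix.diagonal_pow]
    simp only [Matrix.mul_diagonal, Matrix.conjTranspose_apply]
    exact Equiv.sum_comp Equiv.ulift fun j => star (x j s) * z j ^ ((k : ℕ) + 1) * x j t
  have hinner : ∀ (M : Matrix (ULift.{u} (Fin m)) (ULift.{u} (Fin m)) ℂ)
      (v w : EuclideanSpace ℂ (Fin n)),
      ⟪Matrix.toEuclideanLin X v, Matrix.toEuclideanCLM (𝕜 := ℂ) M (Matrix.toEuclideanLin X w)⟫_ℂ
        = ⟪v, Matrix.toEuclideanCLM (𝕜 := ℂ) (X.conjTranspose * M * X) w⟫_ℂ := by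
    intro M v w
    simp only [EuclideanSpace.inner_eq_star_dotProduct, Matrix.ofLp_toEuclideanCLM,
      Matrix.ofLp_toLpLin,
      Matrix.toLin'_apply]
    rw [dotProduct_comm, dotProduct_comm _ (star v.ofLp), Matrix.star_mulVec,
      ← Matrix.dotProduct_mulVec, Matrix.mulVec_mulVec, Matrix.mulVec_mulVec, Matrix.mul_assoc]
  let V : EuclideanSpace ℂ (Fin n) →ₗᵢ[ℂ] EuclideanSpace ℂ (ULift.{u} (Fin m)) :=
    { toLinearMap := Matrix.toEuclideanLin X
      norm_map' := fun v => by
        have h1 := hinner 1 v v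
        rw [Matrix.mul_one, hX, map_one, map_one] at h1
        rw [@norm_eq_sqrt_re_inner ℂ, @norm_eq_sqrt_re_inner ℂ]
        exact congrArg (fun c : ℂ => Real.sqrt c.re) h1 }
  let W := Matrix.toEuclideanCLM (𝕜 := ℂ) D
  have hz1 : ∀ j, z j * star (z j) = 1 := fun j => by
    rw [Complex.star_def, Complex.mul_conj', hz]; simp
  have hD : star D * D = 1 ∧ D * star D = 1 := by
    rw [Matrix.star_eq_conjTranspose, Matrix.diagonal_conjTranspose]
    simp only [D, Matrix.diagonal_mul_diagonal, Pi.star_apply, mul_comm (star (z _)), hz1]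
    exact ⟨Matrix.diagonal_one, Matrix.diagonal_one⟩
  have hW : W ∈ unitary (EuclideanSpace ℂ (ULift.{u} (Fin m)) →L[ℂ] _) := by
    rw [Unitary.mem_iff, ← map_star, ← map_mul, ← map_mul, hD.1, hD.2, map_one]
    exact ⟨rfl, rfl⟩
  refine ⟨EuclideanSpace ℂ (ULift.{u} (Fin m)), inferInstance, inferInstance, inferInstance, V,
    fun k => W ^ ((k : ℕ) + 1), ⟨fun k => ?_, fun j k => ?_⟩, ?_, fun k => ?_⟩
  · have hu := pow_mem hW ((k : ℕ) + 1)
    rw [Unitary.mem_iff] at hu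
    exact ⟨hu.1.trans hu.2.symm⟩
  · exact Commute.pow_pow (Commute.refl W) _ _
  · exact (gelfandSpectrum_pow_subset hW).trans (subset_convexHull ℝ _)
  · refine ContinuousLinearMap.ext fun w => ext_inner_left ℂ fun v => ?_
    rw [← hXA k, ← hinner, ContinuousLinearMap.comp_apply, ContinuousLinearMap.adjoint_inner_right,
      map_pow]
    rfl

end ToeplitzTuple

/-! ### From a normal dilation to positivity, by Gelfand theory. -/

open WeakDual in
open scoped ComplexOrder Matrix.Norms.L2Operator MatrixOrder in
/-- A matrix over a commutative C⋆-algebra that is positive semidefinite at every character is of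
the form `S* S`. -/
theorem CommCStarAlgebra.exists_conjTranspose_mul_self {𝒜 ι : Type*} [CommCStarAlgebra 𝒜]
    [Fintype ι] [DecidableEq ι] (T : Matrix ι ι 𝒜)
    (hT : ∀ φ : characterSpace ℂ 𝒜, (T.map φ).PosSemidef) :
    ∃ S : Matrix ι ι 𝒜, T = S.conjTranspose * S := by
  have hcont : Continuous fun φ : characterSpace ℂ 𝒜 => T.map φ :=
    continuous_matrix fun i j => (gelfandTransform ℂ 𝒜 (T i j)).continuous
  -- The square root is continuous on the positive cone, so the entries of the pointwise roots are
  -- Gelfand transforms of elements of `𝒜`.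
  have hsqrt : Continuous fun φ : characterSpace ℂ 𝒜 => CFC.sqrt (T.map φ) :=
    CFC.continuousOn_sqrt.comp_continuous hcont fun φ => (hT φ).nonneg
  have happ : ∀ (a : 𝒜) (φ : characterSpace ℂ 𝒜), gelfandStarTransform 𝒜 a φ = φ a :=
    fun a φ => rfl
  refine ⟨Matrix.of fun i j => (gelfandStarTransform 𝒜).symm
    ⟨fun φ => CFC.sqrt (T.map φ) i j, hsqrt.matrix_elem i j⟩, ?_⟩
  ext i j
  apply EquivLike.injective (gelfandStarTransform 𝒜)
  ext φ
  have h1 : star (CFC.sqrt (T.map φ)) * CFC.sqrt (T.map φ) = T.map φ := by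
    rw [(CFC.sqrt_nonneg (T.map φ)).isSelfAdjoint.star_eq,
      CFC.sqrt_mul_sqrt_self _ (hT φ).nonneg]
  have h2 := congrFun (congrFun h1 i) j
  rw [Matrix.map_apply, Matrix.mul_apply] at h2
  rw [happ, ← h2, Matrix.mul_apply, map_sum, ContinuousMap.sum_apply]
  refine Finset.sum_congr rfl fun l _ => ?_
  rw [map_mul, Matrix.conjTranspose_apply, map_star, Matrix.of_apply, Matrix.of_apply,
    StarAlgEquiv.apply_symm_apply,
    StarAlgEquiv.apply_symm_apply]
  rfl

namespace ToeplitzTuple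

open scoped IsMulCommutative in
/-- The C⋆-algebra generated by a normal tuple is commutative. -/
theorem IsNormalTuple.mul_comm_cstarGenerated {d : ℕ} {H : Type u} [NormedAddCommGroup H]
    [InnerProductSpace ℂ H] [CompleteSpace H] {N : Fin d → H →L[ℂ] H} (hN : IsNormalTuple N)
    (a b : cstarGenerated N) : a * b = b * a := by
  have := StarAlgebra.isMulCommutative_adjoin ℂ (s := Set.range N)
    (by rintro _ ⟨j, rfl⟩ _ ⟨k, rfl⟩; exact hN.2 j k)
    -- Fuglede's theorem: an operator commuting with a normal one commutes with its adjoint.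
    (by rintro _ ⟨j, rfl⟩ _ ⟨k, rfl⟩; exact (hN.1 k).commute_star_right (hN.2 j k))
  exact (StarSubalgebra.commRingTopologicalClosure (StarAlgebra.adjoin ℂ (Set.range N))
    mul_comm).mul_comm a b

-- Each character sends `N` to a point of `Ω`, so `Toep(1; N)` is positive at every character and
-- equals `S* S`; compressing by `V` keeps it positive.
open scoped ComplexOrder InnerProductSpace in
theorem HasNormalDilation.isToeplitzPositive {d n : ℕ} {A : Tuple d n}
    (h : HasNormalDilation.{u} (convexHull ℝ (powerStretching d)) A) : IsToeplitzPositive A := by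
  obtain ⟨H, _, _, _, V, N, hN, hspec, hA⟩ := h
  have hclosed : IsClosed (cstarGenerated N : Set (H →L[ℂ] H)) :=
    StarSubalgebra.isClosed_topologicalClosure _
  let _ : CommCStarAlgebra (cstarGenerated N) :=
    { StarSubalgebra.cstarAlgebra (cstarGenerated N) with
      mul_comm := hN.mul_comm_cstarGenerated }
  obtain ⟨S, hS⟩ := CommCStarAlgebra.exists_conjTranspose_mul_self
    (toeplitz (1 : cstarGenerated N) fun k => ⟨N k, mem_cstarGenerated N k⟩) (fun φ => by
      have hmem := posSemidef_toeplitz_of_mem (hspec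
        ⟨WeakDual.CharacterSpace.toAlgHom φ, fun k => rfl⟩)
      convert hmem using 1
      ext i j
      rw [Matrix.map_apply, map_toeplitz φ (fun a => map_star φ a), map_one]
      rfl)
  have hT : ∀ i j, toeplitz (1 : H →L[ℂ] H) N i j = ∑ l, star (S l i : H →L[ℂ] H) * S l j := by
    intro i j
    have h1 := congrArg (Subtype.val) (congrFun (congrFun hS i) j)
    rw [map_toeplitz Subtype.val (fun _ => rfl)] at h1
    rw [Matrix.mul_apply] at h1
    simpa using h1
  -- The compression is unital and preserves `star`, which is all that is needed to carry `Toep(1;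
  -- N)` to `Toep(1; A)`.
  let C : (H →L[ℂ] H) → Matrix (Fin n) (Fin n) ℂ := fun M =>
    (Matrix.toEuclideanCLM (n := Fin n) (𝕜 := ℂ)).symm
      ((ContinuousLinearMap.adjoint V.toContinuousLinearMap) ∘L M ∘L V.toContinuousLinearMap)
  have hCapply : ∀ M s t, C M s t =
      ⟪V (EuclideanSpace.single s 1), M (V (EuclideanSpace.single t 1))⟫_ℂ := by
    intro M s t
    have h1 : Matrix.toEuclideanCLM (n := Fin n) (𝕜 := ℂ) (C M) = _ :=
      (Matrix.toEuclideanCLM (n := Fin n) (𝕜 := ℂ)).apply_symm_apply _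
    have h2 : ⟪EuclideanSpace.single s (1 : ℂ),
        Matrix.toEuclideanCLM (n := Fin n) (𝕜 := ℂ) (C M) (EuclideanSpace.single t 1)⟫_ℂ
          = C M s t := by
      simp [EuclideanSpace.inner_single_left, Matrix.ofLp_toEuclideanCLM]
    rw [← h2, h1, ContinuousLinearMap.comp_apply, ContinuousLinearMap.adjoint_inner_right]
    rfl
  have hCstar : ∀ M, C (star M) = star (C M) := by
    intro M
    ext s t
    rw [Matrix.star_apply, hCapply, hCapply, ContinuousLinearMap.star_eq_adjoint,
      ContinuousLinearMap.adjoint_inner_right, Complex.star_def, inner_conj_symm]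
  have hCone : C 1 = 1 := by
    ext s t
    rw [hCapply, one_apply_eq_self, V.inner_map_map]
    simp [EuclideanSpace.inner_single_left, Matrix.one_apply]
  have hCN : ∀ k, C (N k) = A k := fun k => by
    simp only [C, hA, StarAlgEquiv.symm_apply_apply]
  -- Each row `l` of `S` contributes the Gram matrix of the vectors `S l i (V eₛ)`.
  have hsum := Matrix.posSemidef_sum Finset.univ fun (l : Fin (d + 1)) _ =>
    Matrix.posSemidef_gram ℂ fun q : Fin (d + 1) × Fin n =>
      (S l q.1 : H →L[ℂ] H) (V (EuclideanSpace.single q.2 1))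
  rw [IsToeplitzPositive]
  refine (congrArg Matrix.PosSemidef ?_).mpr hsum
  ext ⟨i, s⟩ ⟨j, t⟩
  change toeplitz (1 : Matrix (Fin n) (Fin n) ℂ) A i j s t = _
  rw [← hCone, ← funext hCN, ← map_toeplitz C hCstar, hCapply, hT, Matrix.sum_apply,
    sum_apply, inner_sum]
  refine Finset.sum_congr rfl fun l _ => ?_
  rw [Matrix.gram_apply, mul_apply_eq_comp, ContinuousLinearMap.star_eq_adjoint,
    ContinuousLinearMap.adjoint_inner_right]

theorem hasNormalDilation_iff {d n : ℕ} (A : Tuple d n) :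
    HasNormalDilation.{u} (convexHull ℝ (powerStretching d)) A ↔ IsToeplitzPositive A :=
  ⟨HasNormalDilation.isToeplitzPositive, IsToeplitzPositive.hasNormalDilation⟩

end ToeplitzTuple

theorem theorem5 (d n : ℕ) (A B : ToeplitzTuple.Tuple d n) :
    ((A ∈ ToeplitzTuple.kMin (convexHull ℝ (ToeplitzTuple.powerStretching d)) n ↔
        ToeplitzTuple.toeplitzModulus A ≤ 1) ∧
      (ToeplitzTuple.HasNormalDilation.{u} (convexHull ℝ (ToeplitzTuple.powerStretching d)) A ↔
        ToeplitzTuple.toeplitzModulus A ≤ 1)) ∧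
    ((B ∈ ToeplitzTuple.kMax (convexHull ℝ (ToeplitzTuple.powerStretching d)) n ↔
        ToeplitzTuple.toeplitzNumericalRadius B ≤ 1) ∧
      (ToeplitzTuple.jointNumericalRange B ⊆ convexHull ℝ (ToeplitzTuple.powerStretching d) ↔
        ToeplitzTuple.toeplitzNumericalRadius B ≤ 1)) :=
  ⟨⟨(ToeplitzTuple.mem_kMin_iff_isToeplitzPositive A).trans
      (ToeplitzTuple.toeplitzModulus_le_one_iff A).symm,
    (ToeplitzTuple.hasNormalDilation_iff A).trans
      (ToeplitzTuple.toeplitzModulus_le_one_iff A).symm⟩,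
    (ToeplitzTuple.mem_kMax_iff (convex_convexHull ℝ _) B).trans
      (ToeplitzTuple.jointNumericalRange_subset_iff B),
    ToeplitzTuple.jointNumericalRange_subset_iff B⟩
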